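/- Let $N\ge 2$ be an integer, $m\in\mathbb R$, and let $L^{1/2,2}(\mathbb R^N)=H^{1/2}(\mathbb R^N)$ be the Bessel potential space. Let $V\colon\mathbb R^N\to\mathbb R$ be continuous with $\inf_{\mathbb R^N}V>-B$ for some $B>0$, put $$\|u\|_X^2=\int_{\mathbb R^N}\bigl|(-\Delta+m^2)^{1/4}u\bigr|^2\,dx+\int_{\mathbb R^N}V|u|^2\,dx,\qquad X=\{u\in L^{1/2,2}(\mathbb R^N):\textstyle\int_{\mathbb R^N} V|u|^2<\infty\},$$ and assume that $\lambda_1=\inf_{u\in X\setminus\{0\}}\|u\|_X^2/\|u\|_{L^2}^2>0$. For an open set $\Omega\subset\mathbb R^N$ and $t\ge 2$ let $$\nu(t,\Omega)=\inf\left\{\frac{\|u\|_X^2}{\left(\int_\Omega|u|^t\right)^{2/t}}\;:\;u\in X,\ u|_\Omega\neq 0\right\},\qquad \nu(t,\emptyset)=+\infty,$$ that is, the test functions on $\Omega$ are the nonzero restrictions to $\Omega$ of functions $u$ on $\mathbb R^N$, and the energy is that of an extension $u$ to $\mathbb R^N$. Let either $2\le t<r<\frac{2N}{N-1}$ or $2<r<t<\frac{2N}{N-1}$.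 Then there are a number $\theta\in(0,1)$, depending only on $r,t,N$, and a constant $C>0$, depending only on $r,t,N,\lambda_1,B$, such that for every open set $\Omega\subset\mathbb R^N$ one has $\nu(t,\Omega)\ge0$ and $$\nu(r,\Omega)\ge C\,\nu(t,\Omega)^{\theta}.$$ In particular, with $B_R=\{x\in\mathbb R^N:|x|<R\}$, if $\lim_{R\to+\infty}\nu(t,\mathbb R^N\setminus\overline{B_R})=+\infty$, then $\lim_{R\to+\infty}\nu(r,\mathbb R^N\setminus\overline{B_R})=+\infty$. All of this also holds if in the definition of $\nu$ only those $u$ are admitted that vanish almost everywhere outside $\Omega$ (extension by zero). -/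

import Mathlib

open MeasureTheory Filter Topology
open scoped FourierTransform ENNReal SchwartzMap

noncomputable section

namespace Semirelativistic

/-- `ℝ^N` with its Euclidean norm. -/
abbrev Space (N : ℕ) : Type := EuclideanSpace ℝ (Fin N)

/-- The (complex) Hilbert space `L²(ℝ^N)`. -/
abbrev L2 (N : ℕ) : Type := Lp (α := Space N) ℂ 2 volume

/-- The Bessel potential space `L^{1/2,2}(ℝ^N)`, as a set of (classes of) square integrable
functions. -/
def besselSpace (N : ℕ) : Set (L2 N) :=
  {u | TemperedDistribution.MemSobolev (1 / 2) 2 (u : 𝓢'(Space N, ℂ))}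

/-- The symbol of `(-Δ + m²)^{1/4}`. The Fourier transform is normalised by the character
`exp (-2 π i ⟨x, ξ⟩)`, so that `-Δ` has the symbol `4 π² |ξ|²`. -/
def symbol {N : ℕ} (m : ℝ) (ξ : Space N) : ℝ :=
  (4 * Real.pi ^ 2 * ‖ξ‖ ^ 2 + m ^ 2) ^ (1 / 4 : ℝ)

open Classical in
/-- The operator `(-Δ + m²)^{1/4}`, the Fourier multiplier with symbol `symbol m`; its domain
consists of all `u` for which `symbol m * 𝓕 u` is square integrable, and contains
`besselSpace N` (outside of the domain the value is `0` by convention). -/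
def quarterPower {N : ℕ} (m : ℝ) (u : L2 N) : L2 N :=
  if h : MemLp (fun ξ : Space N => (symbol m ξ : ℂ) * (𝓕 u : L2 N) ξ) 2 volume then
    𝓕⁻ (h.toLp _)
  else 0

/-- The weighted space `X` of all `u` in `L^{1/2,2}(ℝ^N)` for which `∫ V |u|²` is finite. -/
def spaceX {N : ℕ} (V : Space N → ℝ) : Set (L2 N) :=
  {u | u ∈ besselSpace N ∧ Integrable (fun x => V x * ‖u x‖ ^ 2) volume}

/-- The quadratic form `‖u‖_X² = ∫ |(-Δ + m²)^{1/4} u|² + ∫ V |u|²`, for `u` in `X`. -/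
def energy {N : ℕ} (m : ℝ) (V : Space N → ℝ) (u : L2 N) : ℝ :=
  (∫ x, ‖quarterPower m u x‖ ^ 2) + ∫ x, V x * ‖u x‖ ^ 2

/-- `λ₁`, the infimum of `‖u‖_X² / ‖u‖_2²` over `u` in `X`, `u ≠ 0`. -/
def lambdaOne {N : ℕ} (m : ℝ) (V : Space N → ℝ) : EReal :=
  ⨅ u ∈ {u : L2 N | u ∈ spaceX V ∧ u ≠ 0}, ((energy m V u / ‖u‖ ^ 2 : ℝ) : EReal)

/-- The standing assumption on the potential: `V` is continuous, `inf V > -B` with `B > 0`,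
and `λ₁ > 0`. -/
structure PotentialAssumption {N : ℕ} (m B : ℝ) (V : Space N → ℝ) : Prop where
  continuous : Continuous V
  bound_pos : 0 < B
  lower_bound : ((-B : ℝ) : EReal) < ⨅ x, (V x : EReal)
  lambdaOne_pos : 0 < lambdaOne m V

/-- The operator `(-Δ + m²)^{1/4}` is not local, so the energy of a function given on `Ω` only
makes sense for an extension to `ℝ^N`. The two usual rules: elements of `L^{1/2,2}(Ω)` are
restrictions to `Ω` of functions on `ℝ^N`, and every extension competes (the quotient norm);
or the function is extended by zero. -/
inductive ExtensionRule
  | anyExtension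
  | zeroExtension

/-- The functions on `ℝ^N` that represent the nonzero test functions on `Ω`: they lie in `X`
(the others have infinite energy), they do not vanish a.e. on `Ω`, and under the second
rule they vanish a.e. outside of `Ω`. -/
def testFunctions {N : ℕ} (e : ExtensionRule) (V : Space N → ℝ) (Ω : Set (Space N)) :
    Set (L2 N) :=
  {u | u ∈ spaceX V ∧ ¬ (∀ᵐ x ∂volume.restrict Ω, u x = 0) ∧
    match e with
    | .anyExtension => True
    | .zeroExtension => ∀ᵐ x ∂volume.restrict Ωᶜ, u x = 0}

/-- `ν(t, Ω)`, the infimum of `‖u‖_X² / (∫_Ω |u|^t)^{2/t}` over the nonzero test functions on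
`Ω`. For empty `Ω` there are none, and the value is `+∞`. -/
def nu {N : ℕ} (e : ExtensionRule) (m : ℝ) (V : Space N → ℝ) (t : ℝ) (Ω : Set (Space N)) :
    EReal :=
  ⨅ u ∈ testFunctions e V Ω,
    (energy m V u : EReal) / (((∫⁻ x in Ω, ‖u x‖ₑ ^ t) ^ (2 / t) : ℝ≥0∞) : EReal)

/-- `lim ν(t, ℝ^N \ closure B_R) = +∞` as `R → +∞`. -/
def NuCondition {N : ℕ} (e : ExtensionRule) (m : ℝ) (V : Space N → ℝ) (t : ℝ) : Prop :=
  Tendsto (fun R : ℝ => nu e m V t (closure (Metric.ball 0 R))ᶜ) atTop (𝓝 ⊤)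

end Semirelativistic

end

noncomputable section

namespace Semirelativistic

/-! Write `r = t a + s b` with `a + b = 1`, where `s` lies in `[2, 2N/(N-1))` on the far side of `r`
from `t`. Hölder bounds `∫_Ω |u|^r` by `(∫_Ω |u|^t)^a (∫_Ω |u|^s)^b`. The last factor is at most a
power of the energy: `λ₁ > 0` and `V ≥ -B` let the energy control the `H^{1/2}` norm, and the
subcritical Sobolev inequality on all of `ℝ^N` controls the `L^s` norm. Since `t a / r + s b / r =
1`, the powers of the energy balance and the quotient estimate follows with `θ = t a / r`, for each
test function separately. Only the given extension `u` enters, so `Ω` and the extension rule play no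
role.

The Sobolev inequality is proved by splitting `𝓕 u` at a radius adapted to the level `a`: the low
frequencies are uniformly small, and Chebyshev applied to the high ones gives a weak bound at the
critical exponent (`exists_volume_le_norm_le`). The layer cake formula combines it with the `L²`
bound (`lintegral_rpow_le_of_weak_bound`). -/

/-! ### Fourier transform on `L²` and the Bessel weight -/

theorem lintegral_enorm_sq_eq {N : ℕ} (f : L2 N) :
    ∫⁻ x, ‖f x‖ₑ ^ 2 = ENNReal.ofReal (‖f‖ ^ 2) := by
  have h : eLpNorm f 2 volume ^ 2 = ∫⁻ x, ‖f x‖ₑ ^ 2 := by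
    rw [eLpNorm_eq_lintegral_rpow_enorm_toReal (by norm_num) (by norm_num), ← ENNReal.rpow_natCast,
      ← ENNReal.rpow_mul]
    norm_num
  rw [← h, Lp.norm_def, ENNReal.ofReal_pow ENNReal.toReal_nonneg,
    ENNReal.ofReal_toReal (Lp.eLpNorm_ne_top f)]

theorem integral_norm_sq_eq {N : ℕ} (f : L2 N) : ∫ x, ‖f x‖ ^ 2 = ‖f‖ ^ 2 := by
  rw [integral_eq_lintegral_of_nonneg_ae (Eventually.of_forall fun x => by positivity)
    (by have := Lp.aestronglyMeasurable f; fun_prop)]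
  have : ∀ x, ENNReal.ofReal (‖f x‖ ^ 2) = ‖f x‖ₑ ^ 2 := fun x => by
    rw [ENNReal.ofReal_pow (norm_nonneg _), ofReal_norm]
  simp_rw [this]
  rw [lintegral_enorm_sq_eq, ENNReal.toReal_ofReal (by positivity)]

/-- The inverse Fourier transform of a function in `L¹ ∩ L²` is bounded by its `L¹` norm. -/
theorem ae_norm_fourierInv_le {N : ℕ} (f : L2 N) (hf : Integrable f) :
    ∀ᵐ x, ‖(𝓕⁻ f : L2 N) x‖ ≤ ∫ ξ, ‖f ξ‖ := by
  have hL : Continuous fun p : Space N × Space N => (-innerₗ (Space N)) p.1 p.2 := by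
    simp only [LinearMap.neg_apply, innerₗ_apply_apply]
    fun_prop
  have hcont : Continuous (𝓕⁻ (f : Space N → ℂ)) :=
    VectorFourier.fourierIntegral_continuous Real.continuous_fourierChar hL hf
  have key : (𝓕⁻ f : L2 N) =ᵐ[volume] 𝓕⁻ (f : Space N → ℂ) := by
    -- The `L²` transform and the integral transform are compared as distributions; a smooth
    -- compactly supported test function is a Schwartz function, and the transform can be moved onto
    -- it on both sides.
    apply ae_eq_of_integral_contDiff_smul_eq
    · exact (Lp.memLp (𝓕⁻ f)).locallyIntegrable (by norm_num)
    · exact hcont.locallyIntegrable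
    intro g hg hgc
    have hg₁ : HasCompactSupport (Complex.ofRealCLM ∘ g) := hgc.comp_left rfl
    have hg₂ : ContDiff ℝ ((⊤ : ℕ∞) : WithTop ℕ∞) (Complex.ofRealCLM ∘ g) := by fun_prop
    set φ : 𝓢(Space N, ℂ) := hg₁.toSchwartzMap hg₂ with hφ
    have h1 := congrArg (fun T : 𝓢'(Space N, ℂ) => T φ) (Lp.fourierInv_toTemperedDistribution_eq f)
    simp only [TemperedDistribution.fourierInv_apply, Lp.toTemperedDistribution_apply] at h1
    have h2 : ∫ x, (𝓕⁻ φ) x • f x = ∫ x, φ x • 𝓕⁻ (f : Space N → ℂ) x := by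
      have h := VectorFourier.integral_fourierIntegral_smul_eq_flip Real.continuous_fourierChar hL
        φ.integrable hf (μ := volume) (ν := volume)
      have hflip : (-innerₗ (Space N)).flip = -innerₗ (Space N) := by
        ext x y
        simp [real_inner_comm]
      rw [hflip] at h
      rw [SchwartzMap.fourierInv_coe]
      exact h
    rw [h2] at h1
    simpa [hφ] using h1.symm
  filter_upwards [key] with x hx
  rw [hx]
  exact VectorFourier.norm_fourierIntegral_le_integral_norm _ _ _ _ _

/-- Membership in the Sobolev space is an identity of tempered distributions. Multiplying it by the
bounded inverse weight keeps both sides in `L²`, where the embedding into distributions is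
injective, so it becomes an identity almost everywhere. -/
theorem memLp_weight_mul_fourier {N : ℕ} {u : L2 N} (hu : u ∈ besselSpace N) :
    MemLp (fun ξ : Space N => (((1 + ‖ξ‖ ^ 2) ^ (1 / 4 : ℝ) : ℝ) : ℂ) * (𝓕 u : L2 N) ξ) 2 := by
  obtain ⟨f, hf⟩ := TemperedDistribution.memSobolev_iff_exists_smulLeftCLM_fourier.mp hu
  rw [Lp.fourier_toTemperedDistribution_eq] at hf
  have hg : (fun ξ : Space N => (((1 + ‖ξ‖ ^ 2) ^ (-(1 / 4) : ℝ) : ℝ) : ℂ)).HasTemperateGrowth := by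
    fun_prop
  have hb : MemLp (fun ξ : Space N => (((1 + ‖ξ‖ ^ 2) ^ (-(1 / 4) : ℝ) : ℝ) : ℂ)) ∞ := by
    refine memLp_top_of_bound hg.1.continuous.aestronglyMeasurable 1 (Eventually.of_forall fun ξ => ?_)
    rw [Complex.norm_real, Real.norm_of_nonneg (by positivity)]
    exact Real.rpow_le_one_of_one_le_of_nonpos (by simp) (by norm_num)
  have h1 := Lp.toTemperedDistribution_smul_eq (r := 2) hg hb f
  rw [← hf, TemperedDistribution.smulLeftCLM_smulLeftCLM_apply (by fun_prop) hg] at h1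
  have h2 : ((fun ξ : Space N => (((1 + ‖ξ‖ ^ 2) ^ (1 / 2 / 2 : ℝ) : ℝ) : ℂ)) *
      fun ξ : Space N => (((1 + ‖ξ‖ ^ 2) ^ (-(1 / 4) : ℝ) : ℝ) : ℂ)) = fun _ => 1 := by
    ext ξ
    simp only [Pi.mul_apply]
    norm_cast
    rw [← Real.rpow_add (by positivity)]
    norm_num
  rw [h2, TemperedDistribution.smulLeftCLM_const, one_smul] at h1
  have h3 : (hb.toLp _ • f : L2 N) = 𝓕 u :=
    LinearMap.ker_eq_bot.mp
      (MeasureTheory.Lp.ker_toTemperedDistributionCLM_eq_bot (F := ℂ) (μ := volume) (p := 2)) h1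
  refine (memLp_congr_ae ?_).mp (Lp.memLp f)
  rw [← h3]
  filter_upwards [Lp.coeFn_lpSMul (r := 2) (hb.toLp _) f, hb.coeFn_toLp] with ξ h4 h5
  rw [h4, Pi.smul_apply', h5, smul_eq_mul, ← mul_assoc]
  norm_cast
  rw [← Real.rpow_add (by positivity)]
  norm_num

/-! ### Weak Sobolev bound at the critical exponent -/

/-- The singularity `|ξ|⁻¹` is integrable at the origin because `N > 1`; scaling to the unit ball
gives the power of `A`. -/
theorem exists_lintegral_ball_enorm_inv_le {N : ℕ} (hN : 1 < N) :
    ∃ c : ℝ, 0 < c ∧ ∀ A : ℝ, 0 < A →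
      ∫⁻ ξ in Metric.ball (0 : Space N) A, ‖ξ‖ₑ⁻¹ ≤ ENNReal.ofReal (c * A ^ ((N : ℝ) - 1)) := by
  have : Nonempty (Fin N) := ⟨⟨0, by omega⟩⟩
  have hint : ∀ A : ℝ, IntegrableOn (fun ξ : Space N => ‖ξ‖⁻¹) (Metric.ball 0 A) := fun A => by
    refine integrableOn_ball_of_norm_le_rpow (C := 1) (α := 1) ?_ ?_ ?_ ?_
    · simp; omega
    · simpa using hN
    · refine Eventually.of_forall fun ξ => ?_
      simp [Real.rpow_neg_one]
    · fun_prop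
  set I := ∫ ξ in Metric.ball (0 : Space N) 1, ‖ξ‖⁻¹ with hI
  have hI0 : 0 ≤ I := integral_nonneg fun ξ => by positivity
  refine ⟨I + 1, by positivity, fun A hA => ?_⟩
  have h1 : ∫ ξ in Metric.ball (0 : Space N) A, ‖ξ‖⁻¹ = I * A ^ ((N : ℝ) - 1) := by
    have h := Measure.setIntegral_comp_smul_of_pos (volume : Measure (Space N))
      (fun ξ : Space N => ‖ξ‖⁻¹) (Metric.ball 0 1) hA
    rw [smul_unitBall_of_pos hA] at h
    simp only [norm_smul, mul_inv, integral_const_mul, finrank_euclideanSpace_fin, smul_eq_mul,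
      Real.norm_of_nonneg hA.le, ← hI] at h
    rw [Real.rpow_sub hA, Real.rpow_natCast, Real.rpow_one]
    field_simp at h ⊢
    linarith
  calc ∫⁻ ξ in Metric.ball (0 : Space N) A, ‖ξ‖ₑ⁻¹
      = ∫⁻ ξ in Metric.ball (0 : Space N) A, ENNReal.ofReal (‖ξ‖⁻¹) := by
        refine lintegral_congr_ae (ae_restrict_of_ae ?_)
        filter_upwards [Measure.ae_ne volume (0 : Space N)] with ξ hξ
        rw [ENNReal.ofReal_inv_of_pos (by positivity), ofReal_norm]
    _ = ENNReal.ofReal (I * A ^ ((N : ℝ) - 1)) := by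
        rw [← ofReal_integral_eq_lintegral_ofReal (hint A)
          (Eventually.of_forall fun ξ => by positivity), h1]
    _ ≤ _ := by gcongr; linarith

/-- Cauchy–Schwarz for `|f| = |ξ|^{-1/2} · |ξ|^{1/2} |f|`. -/
theorem lintegral_ball_enorm_le {N : ℕ} (hN : 1 < N) (f : L2 N) (A : ℝ) :
    ∫⁻ ξ in Metric.ball (0 : Space N) A, ‖f ξ‖ₑ ≤
      (∫⁻ ξ in Metric.ball (0 : Space N) A, ‖ξ‖ₑ⁻¹) ^ (1 / 2 : ℝ) *
        (∫⁻ ξ, ‖ξ‖ₑ * ‖f ξ‖ₑ ^ 2) ^ (1 / 2 : ℝ) := by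
  have : Nonempty (Fin N) := ⟨⟨0, by omega⟩⟩
  have hf := Lp.aestronglyMeasurable f
  calc ∫⁻ ξ in Metric.ball (0 : Space N) A, ‖f ξ‖ₑ
      = ∫⁻ ξ in Metric.ball (0 : Space N) A,
          (‖ξ‖ₑ⁻¹) ^ (1 / 2 : ℝ) * (‖ξ‖ₑ * ‖f ξ‖ₑ ^ 2) ^ (1 / 2 : ℝ) := by
        refine lintegral_congr_ae (ae_restrict_of_ae ?_)
        filter_upwards [Measure.ae_ne volume (0 : Space N)] with ξ hξ
        rw [← ENNReal.mul_rpow_of_nonneg _ _ (by norm_num), ← mul_assoc,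
          ENNReal.inv_mul_cancel (by simpa using hξ) (by simp), one_mul, ← ENNReal.rpow_natCast,
          ← ENNReal.rpow_mul]
        norm_num
    _ ≤ (∫⁻ ξ in Metric.ball (0 : Space N) A, ‖ξ‖ₑ⁻¹) ^ (1 / 2 : ℝ) *
        (∫⁻ ξ in Metric.ball (0 : Space N) A, ‖ξ‖ₑ * ‖f ξ‖ₑ ^ 2) ^ (1 / 2 : ℝ) :=
        ENNReal.lintegral_mul_norm_pow_le (by fun_prop)
          (AEMeasurable.restrict (by fun_prop)) (by norm_num) (by norm_num) (by norm_num)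
    _ ≤ _ := by gcongr; exact Measure.restrict_le_self

theorem norm_fourierInv_eq {N : ℕ} (f : L2 N) : ‖(𝓕⁻ f : L2 N)‖ = ‖f‖ := by
  rw [← Lp.norm_fourier_eq (𝓕⁻ f), FourierTransform.fourier_fourierInv_eq]

/-- A weak type bound for the critical exponent `2 N / (N - 1)`. -/
theorem exists_volume_le_norm_le {N : ℕ} (hN : 1 < N) :
    ∃ K : ℝ, 0 < K ∧ ∀ (u : L2 N) (E a : ℝ), 0 < E → 0 < a →
      ∫⁻ ξ, ‖ξ‖ₑ * ‖(𝓕 u : L2 N) ξ‖ₑ ^ 2 ≤ ENNReal.ofReal E →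
      volume {x | a ≤ ‖u x‖} ≤ ENNReal.ofReal (K * (E / a ^ 2) ^ ((N : ℝ) / ((N : ℝ) - 1))) := by
  obtain ⟨c, hc, hball⟩ := exists_lintegral_ball_enorm_inv_le hN
  have hN' : (0 : ℝ) < (N : ℝ) - 1 := by
    have : (1 : ℝ) < N := by exact_mod_cast hN
    linarith
  refine ⟨4 * (16 * c) ^ (1 / ((N : ℝ) - 1)), by positivity, fun u E a hE ha hu => ?_⟩
  set f : L2 N := 𝓕 u with hf
  have hfm := Lp.aestronglyMeasurable f
  -- Chosen so that `(c A^{N-1} E)^{1/2} = a / 4`, the resulting sup bound for the low frequencies.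
  set A : ℝ := (16 * c * (E / a ^ 2)) ^ (-(1 / ((N : ℝ) - 1))) with hAdef
  have hA : 0 < A := by positivity
  have hAN : A ^ ((N : ℝ) - 1) = a ^ 2 / (16 * c * E) := by
    rw [hAdef, ← Real.rpow_mul (by positivity)]
    have : -(1 / ((N : ℝ) - 1)) * ((N : ℝ) - 1) = -1 := by field_simp
    rw [this, Real.rpow_neg_one]
    field_simp
  have hs : MeasurableSet (Metric.ball (0 : Space N) A) := measurableSet_ball
  have hlowM : MemLp ((Metric.ball (0 : Space N) A).indicator f) 2 := (Lp.memLp f).indicator hs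
  have hhighM : MemLp ((Metric.ball (0 : Space N) A)ᶜ.indicator f) 2 :=
    (Lp.memLp f).indicator hs.compl
  set low : L2 N := hlowM.toLp _ with hlow
  set high : L2 N := hhighM.toLp _ with hhigh
  have hsum : f = low + high := by
    apply Lp.ext
    filter_upwards [Lp.coeFn_add low high, hlowM.coeFn_toLp, hhighM.coeFn_toLp] with ξ h1 h2 h3
    rw [h1, Pi.add_apply, h2, h3, Set.indicator_self_add_compl_apply]
  have husum : u = 𝓕⁻ low + 𝓕⁻ high := by
    rw [← FourierTransform.fourierInv_add, ← hsum, hf, FourierTransform.fourierInv_fourier_eq]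
  have hlowL : ∫⁻ ξ, ‖low ξ‖ₑ ≤ ENNReal.ofReal (a / 4) := by
    calc ∫⁻ ξ, ‖low ξ‖ₑ = ∫⁻ ξ in Metric.ball (0 : Space N) A, ‖f ξ‖ₑ := by
          rw [← lintegral_indicator hs]
          refine lintegral_congr_ae ?_
          filter_upwards [hlowM.coeFn_toLp] with ξ h
          rw [h, enorm_indicator_eq_indicator_enorm]
      _ ≤ _ := lintegral_ball_enorm_le hN f A
      _ ≤ ENNReal.ofReal (c * A ^ ((N : ℝ) - 1)) ^ (1 / 2 : ℝ) * ENNReal.ofReal E ^ (1 / 2 : ℝ) := by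
          gcongr
          exact hball A hA
      _ = ENNReal.ofReal (a / 4) := by
          rw [← ENNReal.mul_rpow_of_nonneg _ _ (by norm_num), ← ENNReal.ofReal_mul (by positivity),
            hAN, ENNReal.ofReal_rpow_of_nonneg (by positivity) (by norm_num)]
          congr 1
          have : c * (a ^ 2 / (16 * c * E)) * E = (a / 4) ^ (2 : ℝ) := by
            rw [Real.rpow_two]; field_simp; norm_num
          rw [this, ← Real.rpow_mul (by positivity)]
          norm_num
  have hlowI : Integrable low :=
    ⟨Lp.aestronglyMeasurable low, hlowL.trans_lt ENNReal.ofReal_lt_top⟩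
  have hlowB : ∫ ξ, ‖low ξ‖ ≤ a / 4 := by
    rw [integral_norm_eq_lintegral_enorm hlowI.1]
    exact ENNReal.toReal_le_of_le_ofReal (by positivity) hlowL
  have hhighL : ∫⁻ x, ‖(𝓕⁻ high : L2 N) x‖ₑ ^ 2 ≤ ENNReal.ofReal (E / A) := by
    rw [lintegral_enorm_sq_eq, norm_fourierInv_eq, ← lintegral_enorm_sq_eq,
      ENNReal.ofReal_div_of_pos hA]
    rw [ENNReal.le_div_iff_mul_le (by simp [hA]) (by simp), mul_comm,
      ← lintegral_const_mul' _ _ (by simp)]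
    refine (lintegral_mono_ae ?_).trans hu
    filter_upwards [hhighM.coeFn_toLp] with ξ h
    rw [h]
    by_cases hξ : ξ ∈ Metric.ball (0 : Space N) A
    · simp [hξ]
    · rw [Set.indicator_of_mem (by simpa using hξ)]
      gcongr
      rw [← ofReal_norm]
      exact ENNReal.ofReal_le_ofReal (by simpa using hξ)
  -- Where `|u| ≥ a`, the low part is at most `a / 4`, so the high part is at least `a / 2`; then
  -- Chebyshev.
  calc volume {x | a ≤ ‖u x‖}
      ≤ volume {x | ENNReal.ofReal (a ^ 2 / 4) ≤ ‖(𝓕⁻ high : L2 N) x‖ₑ ^ 2} := by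
        refine measure_mono_ae ?_
        have hadd := Lp.coeFn_add (𝓕⁻ low : L2 N) (𝓕⁻ high)
        rw [← husum] at hadd
        filter_upwards [hadd, ae_norm_fourierInv_le low hlowI] with x h1 h2 hx
        change a ≤ ‖u x‖ at hx
        change ENNReal.ofReal (a ^ 2 / 4) ≤ ‖(𝓕⁻ high : L2 N) x‖ₑ ^ 2
        rw [h1, Pi.add_apply] at hx
        have h3 := norm_add_le ((𝓕⁻ low : L2 N) x) ((𝓕⁻ high : L2 N) x)
        rw [← ofReal_norm, ← ENNReal.ofReal_pow (norm_nonneg _)]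
        apply ENNReal.ofReal_le_ofReal
        have : a / 2 ≤ ‖(𝓕⁻ high : L2 N) x‖ := by linarith
        nlinarith
    _ ≤ (∫⁻ x, ‖(𝓕⁻ high : L2 N) x‖ₑ ^ 2) / ENNReal.ofReal (a ^ 2 / 4) := by
        have := Lp.aestronglyMeasurable (𝓕⁻ high : L2 N)
        exact meas_ge_le_lintegral_div (by fun_prop) (by simp; positivity) (by simp)
    _ ≤ ENNReal.ofReal (E / A) / ENNReal.ofReal (a ^ 2 / 4) := by gcongr
    _ = _ := by
        rw [← ENNReal.ofReal_div_of_pos (by positivity)]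
        congr 1
        have hx : 0 < E / a ^ 2 := by positivity
        have : (N : ℝ) / ((N : ℝ) - 1) = 1 + 1 / ((N : ℝ) - 1) := by field_simp; ring
        rw [this, Real.rpow_add hx, Real.rpow_one, hAdef, Real.rpow_neg (by positivity),
          Real.mul_rpow (by positivity) (by positivity)]
        field_simp

/-! ### From the weak bound to the subcritical Sobolev inequality -/

/-- A weak `L^q` bound for large values and an `L²` bound give an `L^s` bound for `2 ≤ s < q`. -/
theorem lintegral_rpow_le_of_weak_bound {α : Type*} [MeasurableSpace α] {μ : Measure α}
    {f : α → ℝ} (hf0 : 0 ≤ f) (hf : AEMeasurable f μ) {K q s : ℝ} (hK : 0 ≤ K) (hs : 2 ≤ s)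
    (hsq : s < q) (hsq2 : ∫⁻ x, ENNReal.ofReal (f x ^ (2 : ℝ)) ∂μ ≤ 1)
    (hweak : ∀ a : ℝ, 0 < a → μ {x | a ≤ f x} ≤ ENNReal.ofReal (K * a ^ (-q))) :
    ∫⁻ x, ENNReal.ofReal (f x ^ s) ∂μ ≤ ENNReal.ofReal (s + s * (K / (q - s))) := by
  have hs0 : 0 < s := by linarith
  have hqs : 0 < q - s := by linarith
  have h2 := lintegral_rpow_eq_lintegral_meas_le_mul μ (Eventually.of_forall hf0) hf
    (p := 2) (by norm_num)
  -- Layer cake, cut at level 1: below it `a^{s-1} ≤ a` reduces to the `L²` bound; above it the weak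
  -- bound is integrable because `s < q`.
  have hsmall : ∫⁻ a in Set.Ioc (0 : ℝ) 1, μ {x | a ≤ f x} * ENNReal.ofReal (a ^ (s - 1)) ≤ 1 := by
    calc ∫⁻ a in Set.Ioc (0 : ℝ) 1, μ {x | a ≤ f x} * ENNReal.ofReal (a ^ (s - 1))
        ≤ ∫⁻ a in Set.Ioc (0 : ℝ) 1, μ {x | a ≤ f x} * ENNReal.ofReal (a ^ ((2 : ℝ) - 1)) := by
          refine setLIntegral_mono' measurableSet_Ioc fun a ha => ?_
          gcongr _ * ENNReal.ofReal ?_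
          exact Real.rpow_le_rpow_of_exponent_ge ha.1 ha.2 (by linarith)
      _ ≤ ∫⁻ a in Set.Ioi (0 : ℝ), μ {x | a ≤ f x} * ENNReal.ofReal (a ^ ((2 : ℝ) - 1)) :=
          lintegral_mono_set Set.Ioc_subset_Ioi_self
      _ ≤ ENNReal.ofReal 2 *
          ∫⁻ a in Set.Ioi (0 : ℝ), μ {x | a ≤ f x} * ENNReal.ofReal (a ^ ((2 : ℝ) - 1)) :=
          le_mul_of_one_le_left zero_le (by norm_num)
      _ ≤ 1 := h2 ▸ hsq2
  have hlarge : ∫⁻ a in Set.Ioi (1 : ℝ), μ {x | a ≤ f x} * ENNReal.ofReal (a ^ (s - 1)) ≤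
      ENNReal.ofReal (K / (q - s)) := by
    calc ∫⁻ a in Set.Ioi (1 : ℝ), μ {x | a ≤ f x} * ENNReal.ofReal (a ^ (s - 1))
        ≤ ∫⁻ a in Set.Ioi (1 : ℝ), ENNReal.ofReal (K * a ^ (s - 1 - q)) := by
          refine setLIntegral_mono' measurableSet_Ioi fun a ha => ?_
          have ha0 : (0 : ℝ) < a := lt_trans one_pos ha
          calc _ ≤ ENNReal.ofReal (K * a ^ (-q)) * ENNReal.ofReal (a ^ (s - 1)) := by
                gcongr
                exact hweak a ha0
            _ = _ := by
                rw [← ENNReal.ofReal_mul (by positivity), mul_assoc, ← Real.rpow_add ha0]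
                ring_nf
      _ = ENNReal.ofReal (K / (q - s)) := by
          rw [← ofReal_integral_eq_lintegral_ofReal, integral_const_mul,
            integral_Ioi_rpow_of_lt (by linarith) one_pos]
          · congr 1
            rw [Real.one_rpow]
            have : s - 1 - q + 1 = -(q - s) := by ring
            rw [this]
            field_simp
          · exact (integrableOn_Ioi_rpow_of_lt (by linarith) one_pos).const_mul K
          · filter_upwards [ae_restrict_mem measurableSet_Ioi] with a ha
            have ha0 : (0 : ℝ) < a := lt_trans one_pos ha
            positivity
  rw [lintegral_rpow_eq_lintegral_meas_le_mul μ (Eventually.of_forall hf0) hf hs0,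
    ← Set.Ioc_union_Ioi_eq_Ioi zero_le_one,
    lintegral_union measurableSet_Ioi (Set.Ioc_disjoint_Ioi le_rfl)]
  calc _ ≤ ENNReal.ofReal s * (1 + ENNReal.ofReal (K / (q - s))) := by gcongr
    _ = _ := by
      rw [← ENNReal.ofReal_one, ← ENNReal.ofReal_add (by norm_num) (by positivity),
        ← ENNReal.ofReal_mul hs0.le]
      ring_nf

/-- The subcritical Sobolev inequality for `L^{1/2,2}(ℝ^N)`. -/
theorem exists_lintegral_rpow_le {N : ℕ} (hN : 1 < N) {s : ℝ} (hs : 2 ≤ s)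
    (hsN : s < 2 * (N : ℝ) / ((N : ℝ) - 1)) :
    ∃ K : ℝ, 0 < K ∧ ∀ (u : L2 N) (E : ℝ), 0 < E → ‖u‖ ^ 2 ≤ E →
      ∫⁻ ξ, ‖ξ‖ₑ * ‖(𝓕 u : L2 N) ξ‖ₑ ^ 2 ≤ ENNReal.ofReal E →
      ∫⁻ x, ‖u x‖ₑ ^ s ≤ ENNReal.ofReal (K * E ^ (s / 2)) := by
  obtain ⟨K, hK, hweak⟩ := exists_volume_le_norm_le hN
  set q := 2 * (N : ℝ) / ((N : ℝ) - 1) with hq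
  have hqs : 0 < q - s := by linarith
  refine ⟨s + s * (K / (q - s)), by positivity, fun u E hE hu2 huE => ?_⟩
  have hum := Lp.aestronglyMeasurable u
  have hsE : 0 < √E := Real.sqrt_pos.mpr hE
  have hscale : ∀ (p : ℝ) (x : Space N), 0 < p →
      ENNReal.ofReal ((‖u x‖ / √E) ^ p) = ‖u x‖ₑ ^ p / ENNReal.ofReal (E ^ (p / 2)) := by
    intro p x hp
    rw [Real.div_rpow (norm_nonneg _) hsE.le, ENNReal.ofReal_div_of_pos (by positivity),
      ← ENNReal.ofReal_rpow_of_nonneg (norm_nonneg _) hp.le, ofReal_norm, Real.sqrt_eq_rpow,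
      ← Real.rpow_mul hE.le]
    ring_nf
  -- Dividing by `√E` normalises the `L²` bound to 1 and makes the weak constant independent of `E`.
  have main := lintegral_rpow_le_of_weak_bound (μ := volume) (f := fun x => ‖u x‖ / √E)
    (K := K) (q := q) (s := s) (fun x => by positivity) (by fun_prop) hK.le hs hsN ?_ ?_
  · have hs0 : 0 < s := by linarith
    simp_rw [hscale s _ hs0, div_eq_mul_inv] at main
    rw [lintegral_mul_const' _ _ (by simp; positivity), ← div_eq_mul_inv,
      ENNReal.div_le_iff (by simp; positivity) (by simp), ← ENNReal.ofReal_mul (by positivity)] at main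
    exact main
  · simp_rw [hscale 2 _ two_pos, div_eq_mul_inv]
    rw [lintegral_mul_const' _ _ (by simp; positivity), ← div_eq_mul_inv,
      ENNReal.div_le_iff (by simp; positivity) (by simp), one_mul]
    simp only [ENNReal.rpow_ofNat]
    rw [lintegral_enorm_sq_eq]
    simpa using ENNReal.ofReal_le_ofReal hu2
  · intro a ha
    have h := hweak u E (a * √E) hE (by positivity) huE
    simp_rw [le_div_iff₀ hsE]
    refine h.trans (le_of_eq ?_)
    congr 2
    rw [mul_pow, Real.sq_sqrt hE.le]
    have : E / (a ^ 2 * E) = a ^ (-2 : ℝ) := by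
      rw [Real.rpow_neg ha.le, Real.rpow_two]
      field_simp
    rw [this, ← Real.rpow_mul ha.le, hq]
    ring_nf

/-! ### The energy controls the Sobolev norm -/

theorem symbol_nonneg {N : ℕ} (m : ℝ) (ξ : Space N) : 0 ≤ symbol m ξ := by
  unfold symbol; positivity

/-- Dropping `m²` here is what keeps the later constants independent of `m`. -/
theorem norm_le_symbol_sq {N : ℕ} (m : ℝ) (ξ : Space N) : ‖ξ‖ ≤ symbol m ξ ^ 2 := by
  unfold symbol
  rw [← Real.rpow_natCast, ← Real.rpow_mul (by positivity)]
  calc ‖ξ‖ = (‖ξ‖ ^ 2) ^ (1 / 4 * ((2 : ℕ) : ℝ)) := by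
        rw [← Real.rpow_natCast, ← Real.rpow_mul (norm_nonneg _)]
        norm_num
    _ ≤ _ := by
        refine Real.rpow_le_rpow (by positivity) ?_ (by norm_num)
        have h : 1 ≤ 4 * Real.pi ^ 2 := by nlinarith [Real.pi_gt_three]
        nlinarith [mul_le_mul_of_nonneg_right h (sq_nonneg ‖ξ‖), sq_nonneg m]

theorem memLp_symbol_mul_fourier {N : ℕ} (m : ℝ) {u : L2 N} (hu : u ∈ besselSpace N) :
    MemLp (fun ξ : Space N => (symbol m ξ : ℂ) * (𝓕 u : L2 N) ξ) 2 := by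
  refine (memLp_weight_mul_fourier hu).of_le_mul
    (c := (4 * Real.pi ^ 2 + m ^ 2) ^ (1 / 4 : ℝ)) ?_ (Eventually.of_forall fun ξ => ?_)
  · have h1 : Continuous (symbol (N := N) m) :=
      Continuous.rpow_const (by fun_prop) fun _ => Or.inr (by norm_num)
    exact (Complex.continuous_ofReal.comp h1).aestronglyMeasurable.mul
      (Lp.aestronglyMeasurable (𝓕 u))
  · rw [norm_mul, norm_mul, ← mul_assoc, Complex.norm_real, Complex.norm_real,
      Real.norm_of_nonneg (symbol_nonneg m ξ), Real.norm_of_nonneg (by positivity),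
      ← Real.mul_rpow (by positivity) (by positivity)]
    gcongr
    refine Real.rpow_le_rpow (by positivity) ?_ (by norm_num)
    have : 0 ≤ 4 * Real.pi ^ 2 := by positivity
    nlinarith [mul_nonneg (sq_nonneg m) (sq_nonneg ‖ξ‖)]

theorem lintegral_enorm_mul_fourier_sq_le {N : ℕ} (m : ℝ) {u : L2 N} (hu : u ∈ besselSpace N) :
    ∫⁻ ξ, ‖ξ‖ₑ * ‖(𝓕 u : L2 N) ξ‖ₑ ^ 2 ≤ ENNReal.ofReal (∫ x, ‖quarterPower m u x‖ ^ 2) := by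
  have h := memLp_symbol_mul_fourier m hu
  rw [integral_norm_sq_eq, quarterPower, dif_pos h, norm_fourierInv_eq, ← lintegral_enorm_sq_eq]
  refine lintegral_mono_ae ?_
  filter_upwards [h.coeFn_toLp] with ξ hξ
  rw [hξ, enorm_mul, mul_pow]
  gcongr
  rw [← ofReal_norm, ← ofReal_norm, ← ENNReal.ofReal_pow (norm_nonneg _), Complex.norm_real,
    Real.norm_of_nonneg (symbol_nonneg m ξ)]
  exact ENNReal.ofReal_le_ofReal (norm_le_symbol_sq m ξ)

theorem PotentialAssumption.neg_bound_le {N : ℕ} {m B : ℝ} {V : Space N → ℝ}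
    (hV : PotentialAssumption m B V) (x : Space N) : -B ≤ V x := by
  have := hV.lower_bound.le.trans (iInf_le _ x)
  exact_mod_cast this

theorem PotentialAssumption.neg_bound_mul_le_integral {N : ℕ} {m B : ℝ} {V : Space N → ℝ}
    (hV : PotentialAssumption m B V) {u : L2 N} (hu : u ∈ spaceX V) :
    -B * ‖u‖ ^ 2 ≤ ∫ x, V x * ‖u x‖ ^ 2 := by
  rw [← integral_norm_sq_eq, ← integral_const_mul]
  refine integral_mono ?_ hu.2 fun x => ?_
  · exact ((memLp_two_iff_integrable_sq_norm (Lp.aestronglyMeasurable u)).mp (Lp.memLp u)).const_mul _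
  · exact mul_le_mul_of_nonneg_right (hV.neg_bound_le x) (by positivity)

theorem lambdaOne_mul_le_energy {N : ℕ} {m lam : ℝ} {V : Space N → ℝ}
    (hlam : lambdaOne m V = (lam : EReal)) {u : L2 N} (hu : u ∈ spaceX V) (hu0 : u ≠ 0) :
    lam * ‖u‖ ^ 2 ≤ energy m V u := by
  have h : lambdaOne m V ≤ ((energy m V u / ‖u‖ ^ 2 : ℝ) : EReal) := iInf₂_le u ⟨hu, hu0⟩
  rw [hlam] at h
  have h' : lam ≤ energy m V u / ‖u‖ ^ 2 := by exact_mod_cast h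
  rwa [le_div_iff₀ (by positivity)] at h'

/-- On `X` the energy controls the norm of `L^{1/2,2}(ℝ^N)`, with a constant that does not depend
on `m`. -/
theorem PotentialAssumption.sobolev_le_energy {N : ℕ} {m B lam : ℝ} {V : Space N → ℝ}
    (hV : PotentialAssumption m B V) (hlam : lambdaOne m V = (lam : EReal)) {u : L2 N}
    (hu : u ∈ spaceX V) (hu0 : u ≠ 0) :
    0 < lam ∧ 0 < energy m V u ∧ ‖u‖ ^ 2 ≤ (1 + (1 + B) / lam) * energy m V u ∧
      ∫⁻ ξ, ‖ξ‖ₑ * ‖(𝓕 u : L2 N) ξ‖ₑ ^ 2 ≤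
        ENNReal.ofReal ((1 + (1 + B) / lam) * energy m V u) := by
  have hlam0 : 0 < lam := by
    have := hV.lambdaOne_pos
    rw [hlam] at this
    exact_mod_cast this
  have hB := hV.bound_pos
  have h1 := lambdaOne_mul_le_energy hlam hu hu0
  have hpos : 0 < ‖u‖ ^ 2 := by positivity
  have he : 0 < energy m V u := lt_of_lt_of_le (by positivity) h1
  have h2 : ‖u‖ ^ 2 ≤ energy m V u / lam := by rwa [le_div_iff₀ hlam0, mul_comm]
  have h3 := hV.neg_bound_mul_le_integral hu
  have h4 : B * ‖u‖ ^ 2 ≤ B * (energy m V u / lam) := by gcongr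
  -- The `L²` part costs `1 / lam`; the kinetic part costs `1 + B / lam`, since the potential term
  -- is at least `-B ‖u‖²`. The constant is their sum.
  have h5 : (1 + (1 + B) / lam) * energy m V u =
      energy m V u + energy m V u / lam + B * (energy m V u / lam) := by
    field_simp
    ring
  have h6 : 0 < energy m V u / lam := by positivity
  refine ⟨hlam0, he, ?_, (lintegral_enorm_mul_fourier_sq_le m hu.1).trans
    (ENNReal.ofReal_le_ofReal ?_)⟩
  · rw [h5]
    nlinarith
  · rw [h5]
    have h7 : energy m V u = (∫ x, ‖quarterPower m u x‖ ^ 2) + ∫ x, V x * ‖u x‖ ^ 2 := rfl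
    linarith

/-! ### Interpolation of the quotients -/

theorem ne_zero_of_mem_testFunctions {N : ℕ} {e : ExtensionRule} {V : Space N → ℝ}
    {Ω : Set (Space N)} {u : L2 N} (hu : u ∈ testFunctions e V Ω) : u ≠ 0 := by
  rintro rfl
  exact hu.2.1 (ae_restrict_of_ae (Lp.coeFn_zero ℂ 2 volume))

theorem lintegral_rpow_ne_zero_of_mem_testFunctions {N : ℕ} {e : ExtensionRule} {V : Space N → ℝ}
    {Ω : Set (Space N)} {u : L2 N} (hu : u ∈ testFunctions e V Ω) {p : ℝ} (hp : 0 < p) :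
    ∫⁻ x in Ω, ‖u x‖ₑ ^ p ≠ 0 := by
  intro h
  have hm : AEMeasurable (fun x => ‖u x‖ₑ ^ p) (volume.restrict Ω) :=
    ((Lp.aestronglyMeasurable u).enorm.pow_const p).restrict
  rw [lintegral_eq_zero_iff' hm] at h
  refine hu.2.1 ?_
  filter_upwards [h] with x hx
  simpa [hp, hp.not_gt] using hx

theorem energy_div_eq_coe {a : ℝ} {b : ℝ≥0∞} (hb : b ≠ ∞) (p : ℝ) (hp : 0 < p) :
    (a : EReal) / ((b ^ (2 / p) : ℝ≥0∞) : EReal) = ((a / b.toReal ^ (2 / p) : ℝ) : EReal) := by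
  have h : b ^ (2 / p) = ENNReal.ofReal (b.toReal ^ (2 / p)) := by
    rw [← ENNReal.ofReal_rpow_of_nonneg ENNReal.toReal_nonneg (by positivity),
      ENNReal.ofReal_toReal hb]
  rw [h, EReal.coe_ennreal_ofReal, max_eq_left (by positivity), EReal.coe_div]

theorem lintegral_rpow_interpolate {α : Type*} [MeasurableSpace α] {μ : Measure α}
    {f : α → ℝ≥0∞} (hf : AEMeasurable f μ) {t s r a b : ℝ} (ht : 0 < t) (hs : 0 < s)
    (ha : 0 < a) (hb : 0 < b) (hab : a + b = 1) (hr : t * a + s * b = r) :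
    ∫⁻ x, f x ^ r ∂μ ≤ (∫⁻ x, f x ^ t ∂μ) ^ a * (∫⁻ x, f x ^ s ∂μ) ^ b := by
  have h := ENNReal.lintegral_mul_norm_pow_le (hf.pow_const t) (hf.pow_const s) ha.le hb.le hab
  refine le_trans (le_of_eq (lintegral_congr fun x => ?_)) h
  rw [← ENNReal.rpow_mul, ← ENNReal.rpow_mul, ← hr,
    ENNReal.rpow_add_of_nonneg _ _ (by positivity) (by positivity)]

/-- Here `e` is the energy and `x`, `y`, `z` are the integrals with exponents `t`, `r`, `s`. The
powers of `x` cancel, and those of `e` add up to 1 because `t a + s b = r`. -/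
theorem quotient_interpolate {t s r a b K e x y z : ℝ} (ht : 0 < t) (hr0 : 0 < r)
    (ha : 0 < a) (hb : 0 < b) (hr : t * a + s * b = r) (hK : 0 < K) (he : 0 < e)
    (hx : 0 < x) (hy : 0 < y) (hz : 0 ≤ z) (hyx : y ≤ x ^ a * z ^ b) (hzK : z ≤ K * e ^ (s / 2)) :
    K ^ (-(2 * b / r)) * (e / x ^ (2 / t)) ^ (t * a / r) ≤ e / y ^ (2 / r) := by
  have h1 : y ^ (2 / r) ≤ x ^ (2 * a / r) * (K ^ (2 * b / r) * e ^ (s * b / r)) := by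
    calc y ^ (2 / r) ≤ (x ^ a * (K * e ^ (s / 2)) ^ b) ^ (2 / r) := by
          gcongr
          exact hyx.trans (by gcongr)
      _ = _ := by
        rw [Real.mul_rpow (by positivity) (by positivity), ← Real.rpow_mul hx.le,
          ← Real.rpow_mul (by positivity), Real.mul_rpow hK.le (by positivity),
          ← Real.rpow_mul he.le]
        rw [show a * (2 / r) = 2 * a / r by ring, show b * (2 / r) = 2 * b / r by ring,
          show s / 2 * (2 * b / r) = s * b / r by ring]
  rw [le_div_iff₀ (by positivity)]
  calc _ ≤ K ^ (-(2 * b / r)) * (e / x ^ (2 / t)) ^ (t * a / r) *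
        (x ^ (2 * a / r) * (K ^ (2 * b / r) * e ^ (s * b / r))) := by gcongr
    _ = e ^ (t * a / r) * e ^ (s * b / r) := by
        rw [Real.div_rpow he.le (by positivity), ← Real.rpow_mul hx.le, Real.rpow_neg hK.le]
        have : 2 / t * (t * a / r) = 2 * a / r := by field_simp
        rw [this]
        field_simp
    _ = e := by
        rw [← Real.rpow_add he, ← add_div, hr, div_self hr0.ne', Real.rpow_one]

/-- Ensures that `toENNReal` in the main estimate truncates nothing. -/
theorem nu_nonneg {N : ℕ} (e : ExtensionRule) {m B lam : ℝ} {V : Space N → ℝ}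
    (hV : PotentialAssumption m B V) (hlam : lambdaOne m V = (lam : EReal)) (t : ℝ)
    (Ω : Set (Space N)) : 0 ≤ nu e m V t Ω := by
  refine le_iInf₂ fun u hu => EReal.div_nonneg ?_ (by positivity)
  exact_mod_cast (hV.sobolev_le_energy hlam hu.1 (ne_zero_of_mem_testFunctions hu)).2.1.le

/-- The estimate of `ν(r, Ω)` by `ν(t, Ω)`, where `r` is a convex combination of `t` and `s`. -/
theorem exists_nu_rpow_le {N : ℕ} (hN : 1 < N) (e : ExtensionRule) {t s r a b : ℝ}
    (ht : 2 ≤ t) (htN : t < 2 * (N : ℝ) / ((N : ℝ) - 1)) (hs : 2 ≤ s)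
    (hsN : s < 2 * (N : ℝ) / ((N : ℝ) - 1)) (ha : 0 < a) (hb : 0 < b) (hab : a + b = 1)
    (hr : t * a + s * b = r) (B lam : ℝ) :
    ∃ C : ℝ, 0 < C ∧ ∀ (m : ℝ) (V : Space N → ℝ), PotentialAssumption m B V →
      lambdaOne m V = (lam : EReal) → ∀ Ω : Set (Space N),
        (C : EReal) * (((nu e m V t Ω).toENNReal ^ (t * a / r) : ℝ≥0∞) : EReal) ≤
          nu e m V r Ω := by
  -- `C` is chosen before `m` and `V`; if `B` or `lam` is not positive, no potential is admissible
  -- and any `C` serves.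
  by_cases hpos : 0 < B ∧ 0 < lam
  swap
  · refine ⟨1, one_pos, fun m V hV hlam => absurd ⟨hV.bound_pos, ?_⟩ hpos⟩
    have := hV.lambdaOne_pos
    rw [hlam] at this
    exact_mod_cast this
  obtain ⟨hB, hlam0⟩ := hpos
  have ht0 : 0 < t := by linarith
  have hs0 : 0 < s := by linarith
  have hr0 : 0 < r := by rw [← hr]; positivity
  obtain ⟨Kt, hKt, htS⟩ := exists_lintegral_rpow_le hN ht htN
  obtain ⟨Ks, hKs, hsS⟩ := exists_lintegral_rpow_le hN hs hsN
  set D := 1 + (1 + B) / lam with hD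
  have hD0 : 0 < D := by positivity
  have hK : 0 < Ks * D ^ (s / 2) := by positivity
  refine ⟨(Ks * D ^ (s / 2)) ^ (-(2 * b / r)), by positivity, fun m V hV hlam Ω => ?_⟩
  refine le_iInf₂ fun u hu => ?_
  obtain ⟨-, he, hu2, huE⟩ := hV.sobolev_le_energy hlam hu.1 (ne_zero_of_mem_testFunctions hu)
  set E := energy m V u
  have hum : AEMeasurable (fun x => ‖u x‖ₑ) (volume.restrict Ω) :=
    (Lp.aestronglyMeasurable u).enorm.restrict
  -- Finiteness comes from the Sobolev inequality on `ℝ^N`, so no regularity of `Ω` is needed, and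
  -- the extended quotients become real ones.
  have hIt : ∫⁻ x in Ω, ‖u x‖ₑ ^ t ≠ ∞ :=
    ne_top_of_le_ne_top ENNReal.ofReal_ne_top
      ((setLIntegral_le_lintegral _ _).trans (htS u _ (by positivity) hu2 huE))
  have hIs' : ∫⁻ x in Ω, ‖u x‖ₑ ^ s ≤ ENNReal.ofReal (Ks * (D * E) ^ (s / 2)) :=
    (setLIntegral_le_lintegral _ _).trans (hsS u _ (by positivity) hu2 huE)
  have hIs : ∫⁻ x in Ω, ‖u x‖ₑ ^ s ≠ ∞ := ne_top_of_le_ne_top ENNReal.ofReal_ne_top hIs'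
  have hint := lintegral_rpow_interpolate hum ht0 hs0 ha hb hab hr
  have htop : (∫⁻ x in Ω, ‖u x‖ₑ ^ t) ^ a * (∫⁻ x in Ω, ‖u x‖ₑ ^ s) ^ b ≠ ∞ :=
    ENNReal.mul_ne_top (ENNReal.rpow_ne_top_of_nonneg ha.le hIt)
      (ENNReal.rpow_ne_top_of_nonneg hb.le hIs)
  have hIr : ∫⁻ x in Ω, ‖u x‖ₑ ^ r ≠ ∞ := ne_top_of_le_ne_top htop hint
  have hint' := ENNReal.toReal_mono htop hint
  rw [ENNReal.toReal_mul, ← ENNReal.toReal_rpow, ← ENNReal.toReal_rpow] at hint'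
  have hIs'' := ENNReal.toReal_le_of_le_ofReal (by positivity) hIs'
  rw [Real.mul_rpow hD0.le he.le, ← mul_assoc] at hIs''
  have key := quotient_interpolate ht0 hr0 ha hb hr hK he
    (ENNReal.toReal_pos (lintegral_rpow_ne_zero_of_mem_testFunctions hu ht0) hIt)
    (ENNReal.toReal_pos (lintegral_rpow_ne_zero_of_mem_testFunctions hu hr0) hIr)
    ENNReal.toReal_nonneg hint' hIs''
  rw [energy_div_eq_coe hIr r hr0]
  refine le_trans ?_ (EReal.coe_le_coe_iff.mpr key)
  have hnu : nu e m V t Ω ≤ ((E / (∫⁻ x in Ω, ‖u x‖ₑ ^ t).toReal ^ (2 / t) : ℝ) : EReal) := by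
    rw [← energy_div_eq_coe hIt t ht0]
    exact iInf₂_le u hu
  rw [EReal.coe_mul]
  refine mul_le_mul_of_nonneg_left ?_ (by exact_mod_cast (by positivity))
  have h1 := EReal.toENNReal_le_toENNReal hnu
  rw [EReal.toENNReal_of_ne_top (EReal.coe_ne_top _), EReal.toReal_coe] at h1
  have h2 := ENNReal.rpow_le_rpow h1 (show 0 ≤ t * a / r by positivity)
  rw [ENNReal.ofReal_rpow_of_nonneg (by positivity) (by positivity)] at h2
  have h3 := EReal.coe_ennreal_le_coe_ennreal_iff.mpr h2
  rwa [EReal.coe_ennreal_ofReal, max_eq_left (by positivity)] at h3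

/-! ### Divergence at infinity and choice of exponents -/

theorem tendsto_top_of_mul_rpow_le {f g : ℝ → EReal} {C θ : ℝ} (hC : 0 < C) (hθ : 0 < θ)
    {l : Filter ℝ} (h : ∀ R, (C : EReal) * (((f R).toENNReal ^ θ : ℝ≥0∞) : EReal) ≤ g R)
    (hf : Tendsto f l (𝓝 ⊤)) : Tendsto g l (𝓝 ⊤) := by
  rw [EReal.tendsto_nhds_top_iff_real] at hf ⊢
  intro x
  -- Gives `C y = max x 0 + C > x`; the threshold `y ^ θ⁻¹` for `f` then forces `f ^ θ ≥ y`.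
  set y : ℝ := max x 0 / C + 1 with hy
  have hy0 : 0 < y := by positivity
  filter_upwards [hf (y ^ θ⁻¹)] with R hR
  have h1 := EReal.toENNReal_le_toENNReal hR.le
  rw [EReal.toENNReal_of_ne_top (EReal.coe_ne_top _), EReal.toReal_coe] at h1
  have h2 := ENNReal.rpow_le_rpow h1 hθ.le
  rw [ENNReal.ofReal_rpow_of_nonneg (by positivity) hθ.le, ← Real.rpow_mul hy0.le,
    inv_mul_cancel₀ hθ.ne', Real.rpow_one] at h2
  have h3 := EReal.coe_ennreal_le_coe_ennreal_iff.mpr h2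
  rw [EReal.coe_ennreal_ofReal, max_eq_left hy0.le] at h3
  calc (x : EReal) < ((C * y : ℝ) : EReal) := by
        rw [EReal.coe_lt_coe_iff, hy, mul_add, mul_div_cancel₀ _ hC.ne']
        linarith [le_max_left x 0]
    _ = (C : EReal) * (y : EReal) := EReal.coe_mul _ _
    _ ≤ _ := mul_le_mul_of_nonneg_left h3 (by exact_mod_cast hC.le)
    _ ≤ g R := h R

theorem exists_interpolation_exponent {q t r : ℝ}
    (htr : (2 ≤ t ∧ t < r ∧ r < q) ∨ (2 < r ∧ r < t ∧ t < q)) :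
    ∃ s a b : ℝ, 2 ≤ s ∧ s < q ∧ 0 < a ∧ 0 < b ∧ a + b = 1 ∧ t * a + s * b = r := by
  have main : ∀ s : ℝ, 2 ≤ s → s < q → 0 < (s - r) / (s - t) → 0 < (r - t) / (s - t) → s ≠ t →
      ∃ s a b : ℝ, 2 ≤ s ∧ s < q ∧ 0 < a ∧ 0 < b ∧ a + b = 1 ∧ t * a + s * b = r := by
    intro s hs hsq ha hb hst
    have : s - t ≠ 0 := sub_ne_zero.mpr hst
    exact ⟨s, _, _, hs, hsq, ha, hb, by field_simp; ring, by field_simp; ring⟩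
  rcases htr with ⟨h1, h2, h3⟩ | ⟨h1, h2, h3⟩
  -- Any `s` strictly between `r` and `q` would do.
  · exact main ((r + q) / 2) (by linarith) (by linarith) (div_pos (by linarith) (by linarith))
      (div_pos (by linarith) (by linarith)) (by linarith)
  -- With `s = 2`, the strict inequality `2 < r` is what makes the weight `a` of `t` positive.
  · exact main 2 le_rfl (by linarith) (div_pos_of_neg_of_neg (by linarith) (by linarith))
      (div_pos_of_neg_of_neg (by linarith) (by linarith)) (by linarith)

end Semirelativistic

end

theorem lemma3p1 (N : ℕ) (hN : 1 < N) (e : Semirelativistic.ExtensionRule) (t r : ℝ)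
    (htr : (2 ≤ t ∧ t < r ∧ r < 2 * (N : ℝ) / ((N : ℝ) - 1)) ∨
      (2 < r ∧ r < t ∧ t < 2 * (N : ℝ) / ((N : ℝ) - 1))) :
    ∃ θ : ℝ, 0 < θ ∧ θ < 1 ∧ ∀ B lam : ℝ, ∃ C : ℝ, 0 < C ∧
      ∀ (m : ℝ) (V : Semirelativistic.Space N → ℝ),
        Semirelativistic.PotentialAssumption m B V →
        Semirelativistic.lambdaOne m V = (lam : EReal) →
        (∀ Ω : Set (Semirelativistic.Space N), IsOpen Ω →
          0 ≤ Semirelativistic.nu e m V t Ω ∧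
          (C : EReal) * (((Semirelativistic.nu e m V t Ω).toENNReal ^ θ : ENNReal) : EReal) ≤
            Semirelativistic.nu e m V r Ω) ∧
        (Semirelativistic.NuCondition e m V t → Semirelativistic.NuCondition e m V r) := by
  obtain ⟨s, a, b, hs, hsN, ha, hb, hab, hr⟩ :=
    Semirelativistic.exists_interpolation_exponent htr
  have ht : 2 ≤ t := by rcases htr with h | h <;> linarith [h.1, h.2.1]
  have htN : t < 2 * (N : ℝ) / ((N : ℝ) - 1) := by rcases htr with h | h <;> linarith [h.2.1, h.2.2]
  have hta : 0 < t * a := by positivity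
  have hsb : 0 < s * b := by positivity
  have hθ : 0 < t * a / r := div_pos hta (by linarith)
  refine ⟨t * a / r, hθ, (div_lt_one (by linarith)).mpr (by linarith), fun B lam => ?_⟩
  obtain ⟨C, hC, h⟩ :=
    Semirelativistic.exists_nu_rpow_le hN e ht htN hs hsN ha hb hab hr B lam
  refine ⟨C, hC, fun m V hV hlam => ⟨fun Ω _ => ⟨Semirelativistic.nu_nonneg e hV hlam t Ω,
    h m V hV hlam Ω⟩, fun hcond => ?_⟩⟩
  exact Semirelativistic.tendsto_top_of_mul_rpow_le hC hθ (fun R => h m V hV hlam _) hcond
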